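/- Let $m,n$ be natural numbers and let $Z_1,\dots,Z_m$ be complex $n\times n$ matrices. Let $r_{i1},\dots,r_{in}$ denote the singular values of $Z_i$ (with multiplicity), and assume $0\le r_{ik}<1$ for all $i,k$. Let $w_1,\dots,w_m>0$ be real numbers with $\sum_{i=1}^m w_i=1$, and let $U$ be an $n\times n$ unitary matrix. For a complex matrix $A$ write $|A|$ for the positive semidefinite square root of $A^*A$, and ${\rm Spec}(A)$ for the multiset of its $n$ eigenvalues, counted with algebraic multiplicity. Then $\det\bigl(I-U\sum_{i=1}^m w_i|Z_i|\bigr)\neq 0$ and $$\frac{\det\bigl(I-\sum_{i=1}^m w_iZ_i^*Z_i\bigr)}{\bigl|\det\bigl(I-U\sum_{i=1}^m w_i|Z_i|\bigr)\bigr|^2}\le\prod_{k=1}^n\prod_{i=1}^m\left(\frac{1+r_{ik}}{1-r_{ik}}\right)^{w_i}$$ (the determinant in the numerator is real). Equality holds if and only if there is a matrix $Z$ with $|Z_i|=Z$ for all $i$ and ${\rm Spec}(UZ)={\rm Spec}(Z)$; and if this holds with $Z$ nonsingular, then $U=I$. -/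

import Mathlib

open scoped ComplexOrder MatrixOrder

/-- The singular values of a complex `n × n` matrix, in decreasing order and with multiplicity:
those of the operator it defines on Euclidean space. -/
noncomputable def singularValue {n : ℕ} (A : Matrix (Fin n) (Fin n) ℂ) (k : Fin n) : ℝ :=
  (Matrix.toEuclideanLin A).singularValues k

/-- The absolute value `|A|`: the positive semidefinite square root of `Aᴴ * A`. -/
noncomputable def matrixAbs {n : ℕ} (A : Matrix (Fin n) (Fin n) ℂ) :
    Matrix (Fin n) (Fin n) ℂ :=
  CFC.abs A

/-- The spectrum of a complex matrix as the multiset of its `n` eigenvalues, each counted with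
algebraic multiplicity. -/
noncomputable def spec {n : ℕ} (A : Matrix (Fin n) (Fin n) ℂ) : Multiset ℂ :=
  A.charpoly.roots

/-! ### Unitary diagonalisation. -/

namespace Matrix

variable {n : ℕ}

/-! Let `S` be the weighted mean of the `|Z i|`, with eigenvalues `s k`. Since `det (1 - S²) / det
(1 - S)² = ∏ (1 + s k) / (1 - s k)`, three bounds suffice. The numerator is at most `det (1 - S²)`,
because the square is operator convex (`re_det_one_sub_sum_le`). The denominator is at least `det (1
- S)²` (`sq_re_det_one_sub_le`). The last product is controlled by Jensen's trace inequality for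
`log ((1 + x) / (1 - x))` (`prod_eigenvalue_div_le`).

The first two bounds rest on strict monotonicity of the determinant, so overall equality forces `|Z
i| = S` for all `i` and `U * S = S`; the equality case of Jensen is never needed. -/

theorem exists_unitary_conj_eq_matrixAbs (Z : Matrix (Fin n) (Fin n) ℂ) :
    ∃ V ∈ unitaryGroup (Fin n) ℂ,
      matrixAbs Z = V * diagonal (fun k => (singularValue Z k : ℂ)) * Vᴴ := by
  set T := toEuclideanLin Z with hT
  have hn : Module.finrank ℂ (EuclideanSpace ℂ (Fin n)) = n := by simp
  set b := T.isSymmetric_adjoint_comp_self.eigenvectorBasis hn with hb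
  set V : Matrix (Fin n) (Fin n) ℂ :=
    (EuclideanSpace.basisFun (Fin n) ℂ).toBasis.toMatrix b.toBasis with hV
  have hVu : V ∈ unitaryGroup (Fin n) ℂ :=
    (EuclideanSpace.basisFun (Fin n) ℂ).toMatrix_orthonormalBasis_mem_unitary b
  have hVV : V * Vᴴ = 1 := mem_unitaryGroup_iff.1 hVu
  have hVV' : Vᴴ * V = 1 := mem_unitaryGroup_iff'.1 hVu
  have hVe : ∀ i k, V i k = b k i := fun i k => rfl
  set D : Matrix (Fin n) (Fin n) ℂ := diagonal (fun k => (singularValue Z k : ℂ)) with hD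
  -- The columns of `V` are eigenvectors of `Zᴴ * Z`, with eigenvalues the squared singular values.
  have hcol : Zᴴ * Z * V = V * (D * D) := by
    ext i k
    have h := T.isSymmetric_adjoint_comp_self.apply_eigenvectorBasis hn k
    rw [← hb, ← T.sq_singularValues_fin hn k, hT, ← toEuclideanLin_conjTranspose_eq_adjoint] at h
    have h' := congrArg (fun v : EuclideanSpace ℂ (Fin n) => v i) h
    simp [toLpLin_apply, mulVec_mulVec] at h'
    rw [hD, diagonal_mul_diagonal, mul_diagonal, hVe]
    refine Eq.trans ?_ (h'.trans ?_)
    · rfl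
    · simp only [singularValue]; ring
  refine ⟨V, hVu, ?_⟩
  refine CFC.sqrt_unique ?_ ?_
  · calc V * D * Vᴴ * (V * D * Vᴴ) = V * D * (Vᴴ * V) * D * Vᴴ := by simp only [Matrix.mul_assoc]
      _ = V * (D * D) * Vᴴ := by rw [hVV']; simp only [Matrix.mul_assoc, Matrix.mul_one]
      _ = Zᴴ * Z * (V * Vᴴ) := by rw [← hcol]; simp only [Matrix.mul_assoc]
      _ = star Z * Z := by rw [hVV, Matrix.mul_one]; rfl
  · rw [nonneg_iff_posSemidef]
    refine PosSemidef.mul_mul_conjTranspose_same (PosSemidef.diagonal fun k => ?_) V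
    simpa using! LinearMap.singularValues_nonneg _ _

theorem IsHermitian.exists_unitary_conj {S : Matrix (Fin n) (Fin n) ℂ} (hS : S.IsHermitian) :
    ∃ V ∈ unitaryGroup (Fin n) ℂ, ∃ s : Fin n → ℝ,
      S = V * diagonal (fun k => (s k : ℂ)) * Vᴴ := by
  refine ⟨hS.eigenvectorUnitary, hS.eigenvectorUnitary.2, hS.eigenvalues, ?_⟩
  conv_lhs => rw [hS.spectral_theorem, Unitary.conjStarAlgAut_apply]
  rfl

theorem det_unitary_conj {V : Matrix (Fin n) (Fin n) ℂ} (hV : V ∈ unitaryGroup (Fin n) ℂ)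
    (M : Matrix (Fin n) (Fin n) ℂ) : (V * M * Vᴴ).det = M.det := by
  have h : V * Vᴴ = 1 := mem_unitaryGroup_iff.1 hV
  have h2 := congrArg det h
  rw [det_mul, det_one] at h2
  rw [det_mul, det_mul, mul_right_comm, h2, one_mul]

theorem one_add_unitary_conj {V : Matrix (Fin n) (Fin n) ℂ} (hV : V ∈ unitaryGroup (Fin n) ℂ)
    (a : Fin n → ℝ) : 1 + V * diagonal (fun k => (a k : ℂ)) * Vᴴ =
      V * diagonal (fun k => ((1 + a k : ℝ) : ℂ)) * Vᴴ := by
  have h : V * Vᴴ = 1 := mem_unitaryGroup_iff.1 hV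
  have : diagonal (fun k => ((1 + a k : ℝ) : ℂ)) = 1 + diagonal (fun k => (a k : ℂ)) := by
    rw [← diagonal_one, diagonal_add]; simp
  rw [this, Matrix.mul_add, Matrix.add_mul, Matrix.mul_one, h]

theorem one_sub_unitary_conj {V : Matrix (Fin n) (Fin n) ℂ} (hV : V ∈ unitaryGroup (Fin n) ℂ)
    (a : Fin n → ℝ) : 1 - V * diagonal (fun k => (a k : ℂ)) * Vᴴ =
      V * diagonal (fun k => ((1 - a k : ℝ) : ℂ)) * Vᴴ := by
  have h : V * Vᴴ = 1 := mem_unitaryGroup_iff.1 hV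
  have : diagonal (fun k => ((1 - a k : ℝ) : ℂ)) = 1 - diagonal (fun k => (a k : ℂ)) := by
    rw [← diagonal_one, diagonal_sub]; simp
  rw [this, Matrix.mul_sub, Matrix.sub_mul, Matrix.mul_one, h]

theorem posDef_unitary_conj_diagonal {V : Matrix (Fin n) (Fin n) ℂ}
    (hV : V ∈ unitaryGroup (Fin n) ℂ) {a : Fin n → ℝ} (ha : ∀ k, 0 < a k) :
    (V * diagonal (fun k => (a k : ℂ)) * Vᴴ).PosDef := by
  have h : IsUnit V := (Unitary.toUnits ⟨V, hV⟩).isUnit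
  refine (IsUnit.posDef_star_right_conjugate_iff h).2 (PosDef.diagonal fun k => ?_)
  simpa using ha k

theorem posSemidef_unitary_conj_diagonal (V : Matrix (Fin n) (Fin n) ℂ) {a : Fin n → ℝ}
    (ha : ∀ k, 0 ≤ a k) : (V * diagonal (fun k => (a k : ℂ)) * Vᴴ).PosSemidef := by
  refine PosSemidef.mul_mul_conjTranspose_same (PosSemidef.diagonal fun k => ?_) V
  simpa using ha k

/-! ### Strict monotonicity of the determinant. -/

theorem one_add_sum_le_prod_one_add {ι : Type*} (t : Finset ι) {f : ι → ℝ}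
    (hf : ∀ i ∈ t, 0 ≤ f i) : 1 + ∑ i ∈ t, f i ≤ ∏ i ∈ t, (1 + f i) := by
  classical
  induction t using Finset.induction_on with
  | empty => simp
  | insert i t hi ih =>
    rw [Finset.sum_insert hi, Finset.prod_insert hi]
    have h1 := ih fun j hj => hf j (Finset.mem_insert_of_mem hj)
    have h2 := hf i (Finset.mem_insert_self i t)
    have h3 := Finset.sum_nonneg fun j hj => hf j (Finset.mem_insert_of_mem hj)
    nlinarith

theorem PosSemidef.one_le_re_det_one_add {P : Matrix (Fin n) (Fin n) ℂ} (hP : P.PosSemidef) :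
    1 ≤ (1 + P).det.re ∧ ((1 + P).det.re = 1 → P = 0) := by
  have hdet : (1 + P).det = ((∏ k, (1 + hP.1.eigenvalues k) : ℝ) : ℂ) := by
    conv_lhs => rw [hP.1.spectral_theorem, Unitary.conjStarAlgAut_apply]
    refine (congrArg det (one_add_unitary_conj hP.1.eigenvectorUnitary.2
      hP.1.eigenvalues)).trans ?_
    rw [det_unitary_conj hP.1.eigenvectorUnitary.2, det_diagonal]
    push_cast; rfl
  have h0 := hP.eigenvalues_nonneg
  have hsum : 1 + ∑ k, hP.1.eigenvalues k ≤ ∏ k, (1 + hP.1.eigenvalues k) := by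
    exact one_add_sum_le_prod_one_add Finset.univ fun k _ => h0 k
  have hs0 : 0 ≤ ∑ k, hP.1.eigenvalues k := Finset.sum_nonneg fun k _ => h0 k
  rw [hdet, Complex.ofReal_re]
  refine ⟨by linarith, fun h => ?_⟩
  have : ∑ k, hP.1.eigenvalues k = 0 := by linarith
  rw [Finset.sum_eq_zero_iff_of_nonneg fun k _ => h0 k] at this
  exact hP.1.eigenvalues_eq_zero_iff.1 (funext fun k => this k (Finset.mem_univ k))

theorem PosDef.re_det_pos {X : Matrix (Fin n) (Fin n) ℂ} (hX : X.PosDef) :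
    0 < X.det.re ∧ (X.det.re : ℂ) = X.det := by
  have h := Complex.pos_iff.1 hX.det_pos
  exact ⟨h.1, Complex.ext rfl h.2⟩

/-- Writing `X = C * Cᴴ` and conjugating by `C⁻¹` reduces to `X = 1`, where the product of the `1 +
λ` is at least `1 + ∑ λ`. -/
theorem PosDef.re_det_le_re_det_add {X Y : Matrix (Fin n) (Fin n) ℂ} (hX : X.PosDef)
    (hY : Y.PosSemidef) :
    X.det.re ≤ (X + Y).det.re ∧ ((X + Y).det.re = X.det.re → Y = 0) := by
  obtain ⟨C, hC, hXC⟩ : ∃ C : Matrix (Fin n) (Fin n) ℂ, IsUnit C ∧ X = C * Cᴴ := by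
    obtain ⟨B, hB⟩ := CStarAlgebra.nonneg_iff_eq_mul_star_self.1
      (nonneg_iff_posSemidef.2 hX.posSemidef)
    refine ⟨B, ?_, hB⟩
    have := hX.isUnit
    rw [hB, isUnit_iff_isUnit_det, det_mul] at this
    exact (isUnit_iff_isUnit_det _).2 (isUnit_of_mul_isUnit_left this)
  have hCd : IsUnit C.det := (isUnit_iff_isUnit_det _).1 hC
  set P := C⁻¹ * Y * (C⁻¹)ᴴ with hP
  have hPs : P.PosSemidef := hY.mul_mul_conjTranspose_same _
  have h1 : C * C⁻¹ = 1 := mul_nonsing_inv _ hCd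
  have h2 : (C⁻¹)ᴴ * Cᴴ = 1 := by rw [← conjTranspose_mul, h1, conjTranspose_one]
  have hYP : Y = C * P * Cᴴ := by
    calc Y = (C * C⁻¹) * Y * ((C⁻¹)ᴴ * Cᴴ) := by rw [h1, h2, Matrix.one_mul, Matrix.mul_one]
      _ = _ := by simp only [hP, Matrix.mul_assoc]
  have hXY : X + Y = C * (1 + P) * Cᴴ := by
    rw [Matrix.mul_add, Matrix.add_mul, Matrix.mul_one, ← hYP, ← hXC]
  have hdet : (X + Y).det = X.det * (1 + P).det := by
    rw [hXY, hXC]; simp only [det_mul]; ring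
  obtain ⟨hx, hx'⟩ := hX.re_det_pos
  have hre : (X + Y).det.re = X.det.re * (1 + P).det.re := by
    rw [hdet, ← hx', Complex.re_ofReal_mul, Complex.ofReal_re]
  obtain ⟨h3, h4⟩ := hPs.one_le_re_det_one_add
  refine ⟨by rw [hre]; nlinarith, fun h => ?_⟩
  rw [hYP, h4 (by rw [hre] at h; field_simp at h; exact h)]
  simp

theorem PosSemidef.mul_eq_zero_of_conj {P M : Matrix (Fin n) (Fin n) ℂ} (hP : P.PosSemidef)
    (h : M * P * Mᴴ = 0) : M * P = 0 := by
  obtain ⟨B, rfl⟩ := CStarAlgebra.nonneg_iff_eq_mul_star_self.1 (nonneg_iff_posSemidef.2 hP)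
  have : (M * B) * (M * B)ᴴ = 0 := by
    rw [← h, conjTranspose_mul]; simp only [Matrix.mul_assoc, star_eq_conjTranspose]
  rw [← Matrix.mul_assoc, self_mul_conjTranspose_eq_zero.1 this, Matrix.zero_mul]

/-! ### The denominator. -/

theorem one_sub_mul_inv_mul_one_sub {S U R : Matrix (Fin n) (Fin n) ℂ}
    (hU : U * Uᴴ = 1) (h1 : R * (1 - S) = 1) (h2 : (1 - S) * R = 1) :
    (1 - U * S) * R * (1 - S * Uᴴ) =
      (1 - U * S * Uᴴ) + (1 - U) * (R - 1) * (1 - Uᴴ) := by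
  have h1' : R * S = R - 1 := by
    rw [Matrix.mul_sub, Matrix.mul_one] at h1; rw [← h1]; abel
  have h2' : S * R = R - 1 := by
    rw [Matrix.sub_mul, Matrix.one_mul] at h2; rw [← h2]; abel
  have e1 : (1 - U * S) * R = R - U * (R - 1) := by
    rw [Matrix.sub_mul, Matrix.one_mul, Matrix.mul_assoc, h2']
  have e2 : (R - U * (R - 1)) * (S * Uᴴ) = (R - 1) * Uᴴ - U * (R - 1 - S) * Uᴴ := by
    rw [← Matrix.mul_assoc, Matrix.sub_mul, Matrix.mul_assoc, Matrix.sub_mul R, h1',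
      Matrix.one_mul, Matrix.sub_mul]
  rw [e1, Matrix.mul_sub, e2]
  simp only [Matrix.mul_sub, Matrix.sub_mul, Matrix.mul_one, Matrix.one_mul, hU]
  abel

/-- With `R = (1 - S)⁻¹`, take determinants in the preceding identity: the left side gives `‖det (1
- U * S)‖² / det (1 - S)`, while the right side is a unitary conjugate of `1 - S` plus a positive
semidefinite term. Equality kills that term, so `(1 - U) * (R - 1) = 0`; multiplying by `1 - S`
gives `(1 - U) * S = 0`. -/
theorem sq_re_det_one_sub_le {S U : Matrix (Fin n) (Fin n) ℂ} (hS : S.PosSemidef)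
    (hS1 : (1 - S).PosDef) (hU : U ∈ unitaryGroup (Fin n) ℂ) :
    (1 - S).det.re ^ 2 ≤ ‖(1 - U * S).det‖ ^ 2 ∧
      (‖(1 - U * S).det‖ ^ 2 = (1 - S).det.re ^ 2 → U * S = S) := by
  have hUU : U * Uᴴ = 1 := mem_unitaryGroup_iff.1 hU
  obtain ⟨R, hR⟩ : ∃ R, R = (1 - S)⁻¹ := ⟨_, rfl⟩
  have hd : IsUnit (1 - S).det := (isUnit_iff_isUnit_det _).1 hS1.isUnit
  have h1 : R * (1 - S) = 1 := hR ▸ nonsing_inv_mul _ hd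
  have h2 : (1 - S) * R = 1 := hR ▸ mul_nonsing_inv _ hd
  have hRp : R.PosSemidef := hR ▸ hS1.posSemidef.inv
  have hR1 : (R - 1).PosSemidef := by
    have e : R - 1 = S + S * R * Sᴴ := by
      have h2' : S * R = R - 1 := by
        rw [Matrix.sub_mul, Matrix.one_mul] at h2; rw [← h2]; abel
      have h1' : R * S = R - 1 := by
        rw [Matrix.mul_sub, Matrix.mul_one] at h1; rw [← h1]; abel
      rw [hS.1.eq, h2', Matrix.sub_mul, h1', Matrix.one_mul]; abel
    rw [e]
    exact hS.add (hRp.mul_mul_conjTranspose_same S)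
  have hconj : 1 - U * S * Uᴴ = U * (1 - S) * Uᴴ := by
    rw [Matrix.mul_sub, Matrix.sub_mul, Matrix.mul_one, hUU]
  have hXpd : (1 - U * S * Uᴴ).PosDef := by
    rw [hconj]
    exact (IsUnit.posDef_star_right_conjugate_iff (Unitary.toUnits ⟨U, hU⟩).isUnit).2 hS1
  have hYps : ((1 - U) * (R - 1) * (1 - Uᴴ)).PosSemidef := by
    have h := hR1.mul_mul_conjTranspose_same (1 - U)
    rwa [conjTranspose_sub, conjTranspose_one] at h
  have hXdet : (1 - U * S * Uᴴ).det = (1 - S).det := by rw [hconj, det_unitary_conj hU]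
  obtain ⟨k1, k2⟩ := hXpd.re_det_le_re_det_add hYps
  rw [← one_sub_mul_inv_mul_one_sub hUU h1 h2, hXdet] at k1 k2
  obtain ⟨hp, hp'⟩ := hS1.re_det_pos
  set p := (1 - S).det.re with hpdef
  have hstar : (1 - S * Uᴴ).det = star (1 - U * S).det := by
    rw [← det_conjTranspose]; simp [hS.1.eq]
  have hRd : R.det = ((p⁻¹ : ℝ) : ℂ) := by
    have := congrArg det h1
    rw [det_mul, det_one, ← hp'] at this
    push_cast
    exact eq_inv_of_mul_eq_one_left this
  have hdet : ((1 - U * S) * R * (1 - S * Uᴴ)).det.re = ‖(1 - U * S).det‖ ^ 2 * p⁻¹ := by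
    rw [det_mul, det_mul, hstar, hRd, mul_right_comm]
    have : (1 - U * S).det * star (1 - U * S).det = ((‖(1 - U * S).det‖ ^ 2 : ℝ) : ℂ) := by
      simpa using Complex.mul_conj' (1 - U * S).det
    rw [this, ← Complex.ofReal_mul, Complex.ofReal_re]
  rw [hdet] at k1 k2
  refine ⟨?_, fun h => ?_⟩
  · rw [← div_eq_mul_inv, le_div_iff₀ hp] at k1
    linarith [sq p]
  · have h3 := k2 (by rw [h]; field_simp)
    have h4 : (1 - U) * (R - 1) = 0 := hR1.mul_eq_zero_of_conj (by rw [conjTranspose_sub, conjTranspose_one, h3])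
    have h5 : (1 - U) * ((R - 1) * (1 - S)) = 0 := by
      rw [← Matrix.mul_assoc, h4, Matrix.zero_mul]
    rw [Matrix.sub_mul R, h1, Matrix.one_mul, sub_sub_cancel, Matrix.sub_mul, Matrix.one_mul,
      sub_eq_zero] at h5
    exact h5.symm

/-- Both sides are characteristic polynomials evaluated at `1`. -/
theorem det_one_sub_eq_of_spec_eq {A B : Matrix (Fin n) (Fin n) ℂ} (h : spec A = spec B) :
    (1 - A).det = (1 - B).det := by
  have key : ∀ M : Matrix (Fin n) (Fin n) ℂ,
      (1 - M).det = ((spec M).map fun a => 1 - a).prod := by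
    intro M
    have h1 := eval_charpoly M 1
    rw [map_one] at h1
    rw [← h1, (IsAlgClosed.splits M.charpoly).eval_eq_prod_roots, M.charpoly_monic.leadingCoeff,
      one_mul]
    rfl
  rw [key, key, h]

end Matrix

/-! ### Jensen's trace inequality. -/

theorem convexOn_log_one_add_sub_log_one_sub :
    ConvexOn ℝ (Set.Ico 0 1) fun x : ℝ => Real.log (1 + x) - Real.log (1 - x) := by
  have hd : ∀ x ∈ Set.Ioo (0 : ℝ) 1,
      HasDerivAt (fun x : ℝ => Real.log (1 + x) - Real.log (1 - x)) (2 / (1 - x ^ 2)) x := by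
    intro x hx
    have h1 : 1 + x ≠ 0 := by linarith [hx.1]
    have h2 : 1 - x ≠ 0 := by linarith [hx.2]
    have h3 : 1 - x ^ 2 ≠ 0 := by
      rw [show 1 - x ^ 2 = (1 + x) * (1 - x) by ring]; exact mul_ne_zero h1 h2
    have := (((hasDerivAt_id x).const_add 1).log h1).sub (((hasDerivAt_id x).const_sub 1).log h2)
    refine this.congr_deriv ?_
    simp only [id]
    field_simp
    ring
  refine MonotoneOn.convexOn_of_deriv (convex_Ico 0 1) ?_ ?_ ?_
  · refine ContinuousOn.sub (ContinuousOn.log (by fun_prop) fun x hx => ?_)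
      (ContinuousOn.log (by fun_prop) fun x hx => ?_)
    · linarith [hx.1]
    · linarith [hx.2]
  · rw [interior_Ico]
    exact fun x hx => (hd x hx).differentiableAt.differentiableWithinAt
  · rw [interior_Ico]
    intro x hx y hy hxy
    rw [(hd x hx).deriv, (hd y hy).deriv]
    have h1 := hx.1
    have h2 := hy.2
    have h3 : 0 < 1 - y ^ 2 := by nlinarith
    have h4 : 1 - y ^ 2 ≤ 1 - x ^ 2 := by nlinarith
    gcongr

namespace Matrix

variable {n : ℕ}

theorem sum_normSq_row {W : Matrix (Fin n) (Fin n) ℂ} (hW : W ∈ unitaryGroup (Fin n) ℂ)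
    (j : Fin n) : ∑ k, Complex.normSq (W j k) = 1 := by
  have h := congrFun (congrFun (mem_unitaryGroup_iff.1 hW) j) j
  rw [mul_apply, one_apply_eq] at h
  simp only [star_apply, RCLike.star_def, Complex.mul_conj] at h
  exact_mod_cast h

theorem sum_normSq_col {W : Matrix (Fin n) (Fin n) ℂ} (hW : W ∈ unitaryGroup (Fin n) ℂ)
    (k : Fin n) : ∑ j, Complex.normSq (W j k) = 1 := by
  have h := congrFun (congrFun (mem_unitaryGroup_iff'.1 hW) k) k
  rw [mul_apply, one_apply_eq] at h
  simp only [star_apply, RCLike.star_def, ← Complex.normSq_eq_conj_mul_self] at h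
  exact_mod_cast h

theorem conj_diagonal_apply_self (W : Matrix (Fin n) (Fin n) ℂ) (a : Fin n → ℝ) (j : Fin n) :
    (W * diagonal (fun k => (a k : ℂ)) * Wᴴ) j j =
      ((∑ k, Complex.normSq (W j k) * a k : ℝ) : ℂ) := by
  rw [mul_apply]
  push_cast
  refine Finset.sum_congr rfl fun k _ => ?_
  rw [mul_diagonal, conjTranspose_apply, RCLike.star_def, mul_right_comm, Complex.mul_conj]

/-- The eigenvalues of a convex combination of Hermitian matrices are averages of the eigenvalues
of the matrices. -/
theorem exists_eigenvalue_weights {m : ℕ} {w : Fin m → ℝ} {V : Matrix (Fin n) (Fin n) ℂ}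
    (hV : V ∈ unitaryGroup (Fin n) ℂ) {s : Fin n → ℝ}
    {Q : Fin m → Matrix (Fin n) (Fin n) ℂ} (hQ : ∀ i, Q i ∈ unitaryGroup (Fin n) ℂ)
    {a : Fin m → Fin n → ℝ}
    (h : ∑ i, w i • (Q i * diagonal (fun k => (a i k : ℂ)) * (Q i)ᴴ) =
      V * diagonal (fun k => (s k : ℂ)) * Vᴴ) :
    ∃ p : Fin m → Fin n → Fin n → ℝ, (∀ i j k, 0 ≤ p i j k) ∧ (∀ i j, ∑ k, p i j k = 1) ∧
      (∀ i k, ∑ j, p i j k = 1) ∧ ∀ j, s j = ∑ i, w i * ∑ k, p i j k * a i k := by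
  have hVV : Vᴴ * V = 1 := mem_unitaryGroup_iff'.1 hV
  have hW : ∀ i, Vᴴ * Q i ∈ unitaryGroup (Fin n) ℂ := fun i =>
    mul_mem (Unitary.star_mem hV) (hQ i)
  -- The squared moduli of the entries of a unitary matrix form a doubly stochastic matrix.
  refine ⟨fun i j k => Complex.normSq ((Vᴴ * Q i) j k), fun i j k => Complex.normSq_nonneg _,
    fun i j => sum_normSq_row (hW i) j, fun i k => sum_normSq_col (hW i) k, fun j => ?_⟩
  have h1 : diagonal (fun k => (s k : ℂ)) =
      ∑ i, w i • ((Vᴴ * Q i) * diagonal (fun k => (a i k : ℂ)) * (Vᴴ * Q i)ᴴ) := by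
    calc diagonal (fun k => (s k : ℂ))
        = (Vᴴ * V) * diagonal (fun k => (s k : ℂ)) * (Vᴴ * V) := by
          rw [hVV, Matrix.one_mul, Matrix.mul_one]
      _ = Vᴴ * (V * diagonal (fun k => (s k : ℂ)) * Vᴴ) * V := by simp only [Matrix.mul_assoc]
      _ = _ := by
        rw [← h, Matrix.mul_sum, Matrix.sum_mul]
        refine Finset.sum_congr rfl fun i _ => ?_
        rw [Matrix.mul_smul, Matrix.smul_mul, conjTranspose_mul, conjTranspose_conjTranspose]
        simp only [Matrix.mul_assoc]
  have h2 := congrFun (congrFun h1 j) j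
  rw [diagonal_apply_eq, sum_apply] at h2
  simp only [smul_apply, conj_diagonal_apply_self, Complex.real_smul] at h2
  exact_mod_cast h2

/-- Jensen's trace inequality for a scalar convex function. -/
theorem sum_convexOn_eigenvalue_le {m : ℕ} {w : Fin m → ℝ} (hw : ∀ i, 0 < w i)
    (hw1 : ∑ i, w i = 1) {V : Matrix (Fin n) (Fin n) ℂ}
    (hV : V ∈ unitaryGroup (Fin n) ℂ) {s : Fin n → ℝ}
    {Q : Fin m → Matrix (Fin n) (Fin n) ℂ} (hQ : ∀ i, Q i ∈ unitaryGroup (Fin n) ℂ)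
    {a : Fin m → Fin n → ℝ}
    (h : ∑ i, w i • (Q i * diagonal (fun k => (a i k : ℂ)) * (Q i)ᴴ) =
      V * diagonal (fun k => (s k : ℂ)) * Vᴴ)
    {t : Set ℝ} {f : ℝ → ℝ} (hf : ConvexOn ℝ t f) (ha : ∀ i k, a i k ∈ t) :
    (∀ j, s j ∈ t) ∧ ∑ j, f (s j) ≤ ∑ i, w i * ∑ k, f (a i k) := by
  obtain ⟨p, hp0, hp1, hp2, hs⟩ := exists_eigenvalue_weights hV hQ h
  have hin : ∀ i j, ∑ k, p i j k * a i k ∈ t := fun i j => by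
    simpa using hf.1.sum_mem (fun k _ => hp0 i j k) (hp1 i j) fun k _ => ha i k
  refine ⟨fun j => ?_, ?_⟩
  · rw [hs j]
    simpa using hf.1.sum_mem (fun i _ => (hw i).le) hw1 fun i _ => hin i j
  -- Scalar Jensen is applied over `i`, then over `k`; summing over `j` then removes `p`, whose
  -- column sums are `1`.
  · calc ∑ j, f (s j) ≤ ∑ j, ∑ i, w i * ∑ k, p i j k * f (a i k) := by
          refine Finset.sum_le_sum fun j _ => ?_
          rw [hs j]
          refine le_trans (by
            simpa using hf.map_sum_le (fun i _ => (hw i).le) hw1 fun i _ => hin i j) ?_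
          refine Finset.sum_le_sum fun i _ => mul_le_mul_of_nonneg_left ?_ (hw i).le
          simpa using hf.map_sum_le (fun k _ => hp0 i j k) (hp1 i j) fun k _ => ha i k
      _ = ∑ i, w i * ∑ k, f (a i k) := by
          rw [Finset.sum_comm]
          refine Finset.sum_congr rfl fun i _ => ?_
          rw [← Finset.mul_sum, Finset.sum_comm]
          congr 1
          refine Finset.sum_congr rfl fun k _ => ?_
          rw [← Finset.sum_mul, hp2, one_mul]

theorem prod_eigenvalue_div_le {m : ℕ} {w : Fin m → ℝ} (hw : ∀ i, 0 < w i)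
    (hw1 : ∑ i, w i = 1) {V : Matrix (Fin n) (Fin n) ℂ}
    (hV : V ∈ unitaryGroup (Fin n) ℂ) {s : Fin n → ℝ}
    {Q : Fin m → Matrix (Fin n) (Fin n) ℂ} (hQ : ∀ i, Q i ∈ unitaryGroup (Fin n) ℂ)
    {a : Fin m → Fin n → ℝ}
    (h : ∑ i, w i • (Q i * diagonal (fun k => (a i k : ℂ)) * (Q i)ᴴ) =
      V * diagonal (fun k => (s k : ℂ)) * Vᴴ)
    (ha : ∀ i k, a i k ∈ Set.Ico (0 : ℝ) 1) :
    (∀ j, s j ∈ Set.Ico (0 : ℝ) 1) ∧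
      ∏ j, ((1 + s j) / (1 - s j)) ≤ ∏ k, ∏ i, ((1 + a i k) / (1 - a i k)) ^ w i := by
  obtain ⟨hs, hle⟩ := sum_convexOn_eigenvalue_le hw hw1 hV hQ h
    convexOn_log_one_add_sub_log_one_sub ha
  have hexp : ∀ x ∈ Set.Ico (0 : ℝ) 1,
      (1 + x) / (1 - x) = Real.exp (Real.log (1 + x) - Real.log (1 - x)) := by
    intro x hx
    rw [Real.exp_sub, Real.exp_log (by linarith [hx.1]), Real.exp_log (by linarith [hx.2])]
  refine ⟨hs, ?_⟩
  have e1 : ∏ j, ((1 + s j) / (1 - s j)) =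
      Real.exp (∑ j, (Real.log (1 + s j) - Real.log (1 - s j))) := by
    rw [Real.exp_sum]
    exact Finset.prod_congr rfl fun j _ => hexp _ (hs j)
  have e2 : ∏ k, ∏ i, ((1 + a i k) / (1 - a i k)) ^ w i =
      Real.exp (∑ i, w i * ∑ k, (Real.log (1 + a i k) - Real.log (1 - a i k))) := by
    rw [Finset.prod_comm, Real.exp_sum]
    refine Finset.prod_congr rfl fun i _ => ?_
    rw [Finset.mul_sum, Real.exp_sum]
    refine Finset.prod_congr rfl fun k _ => ?_
    rw [hexp _ (ha i k), ← Real.exp_mul, mul_comm]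
  rw [e1, e2]
  exact Real.exp_le_exp.2 hle

/-! ### The numerator. -/

theorem sum_smul_sub_mul_conjTranspose {m : ℕ} {w : Fin m → ℝ} (hw1 : ∑ i, w i = 1)
    {A : Fin m → Matrix (Fin n) (Fin n) ℂ} {S : Matrix (Fin n) (Fin n) ℂ}
    (hA : ∀ i, (A i).IsHermitian) (hS : S = ∑ i, w i • A i) :
    ∑ i, w i • ((A i - S) * (A i - S)ᴴ) = ∑ i, w i • (A i * A i) - S * S := by
  have hSh : Sᴴ = S := by
    rw [hS, conjTranspose_sum]
    simp [conjTranspose_smul, (hA _).eq]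
  have e1 : ∑ i, w i • (A i * S) = S * S := by
    conv_rhs => rw [hS, Matrix.sum_mul]
    rw [← hS]; simp only [Matrix.smul_mul]
  have e2 : ∑ i, w i • (S * A i) = S * S := by
    conv_rhs => rw [hS, Matrix.mul_sum]
    rw [← hS]; simp only [Matrix.mul_smul]
  have e3 : ∑ i, w i • (S * S) = S * S := by rw [← Finset.sum_smul, hw1, one_smul]
  simp only [conjTranspose_sub, (hA _).eq, hSh, Matrix.mul_sub, Matrix.sub_mul, smul_sub,
    Finset.sum_sub_distrib, e1, e2, e3]
  abel

/-- The two matrices differ by the variance of the `A i`, a positive combination of the `(A i - S) *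
(A i - S)ᴴ`; it vanishes only if every `A i` equals the mean. -/
theorem re_det_one_sub_sum_le {m : ℕ} {w : Fin m → ℝ} (hw : ∀ i, 0 < w i) (hw1 : ∑ i, w i = 1)
    {A : Fin m → Matrix (Fin n) (Fin n) ℂ} {S : Matrix (Fin n) (Fin n) ℂ}
    (hA : ∀ i, (A i).IsHermitian) (hS : S = ∑ i, w i • A i)
    (hX : (1 - ∑ i, w i • (A i * A i)).PosDef) :
    (1 - ∑ i, w i • (A i * A i)).det.re ≤ (1 - S * S).det.re ∧
      ((1 - ∑ i, w i • (A i * A i)).det.re = (1 - S * S).det.re → ∀ i, A i = S) := by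
  have hY0 : ∀ i, 0 ≤ w i • ((A i - S) * (A i - S)ᴴ) := fun i =>
    nonneg_iff_posSemidef.2 ((posSemidef_self_mul_conjTranspose _).smul (hw i).le)
  have hY : (∑ i, w i • ((A i - S) * (A i - S)ᴴ)).PosSemidef :=
    nonneg_iff_posSemidef.1 (Finset.sum_nonneg fun i _ => hY0 i)
  obtain ⟨h1, h2⟩ := hX.re_det_le_re_det_add hY
  have e : 1 - ∑ i, w i • (A i * A i) + ∑ i, w i • ((A i - S) * (A i - S)ᴴ) = 1 - S * S := by
    rw [sum_smul_sub_mul_conjTranspose hw1 hA hS]; abel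
  rw [e] at h1 h2
  refine ⟨h1, fun h i => ?_⟩
  have h3 := (Finset.sum_eq_zero_iff_of_nonneg fun i _ => hY0 i).1 (h2 h.symm) i
    (Finset.mem_univ i)
  exact sub_eq_zero.1
    (self_mul_conjTranspose_eq_zero.1 ((smul_eq_zero.1 h3).resolve_left (hw i).ne'))

end Matrix

/-! ### Assembly and the equality case. -/

open Matrix in
theorem corollary7 {m n : ℕ} (Z : Fin m → Matrix (Fin n) (Fin n) ℂ)
    (hZ : ∀ i k, 0 ≤ singularValue (Z i) k ∧ singularValue (Z i) k < 1)
    (w : Fin m → ℝ) (hw : ∀ i, 0 < w i) (hw1 : ∑ i, w i = 1)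
    (U : Matrix (Fin n) (Fin n) ℂ) (hU : U ∈ Matrix.unitaryGroup (Fin n) ℂ) :
    (1 - U * ∑ i, w i • matrixAbs (Z i)).det ≠ 0 ∧
    (1 - ∑ i, w i • ((Z i).conjTranspose * Z i)).det /
        ((‖(1 - U * ∑ i, w i • matrixAbs (Z i)).det‖ ^ 2 : ℝ) : ℂ) ≤
      ((∏ k : Fin n, ∏ i : Fin m,
        ((1 + singularValue (Z i) k) / (1 - singularValue (Z i) k)) ^ w i : ℝ) : ℂ) ∧
    ((1 - ∑ i, w i • ((Z i).conjTranspose * Z i)).det /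
        ((‖(1 - U * ∑ i, w i • matrixAbs (Z i)).det‖ ^ 2 : ℝ) : ℂ) =
      ((∏ k : Fin n, ∏ i : Fin m,
        ((1 + singularValue (Z i) k) / (1 - singularValue (Z i) k)) ^ w i : ℝ) : ℂ) ↔
      ∃ Z₀ : Matrix (Fin n) (Fin n) ℂ,
        (∀ i, matrixAbs (Z i) = Z₀) ∧ spec (U * Z₀) = spec Z₀) ∧
    (∀ Z₀ : Matrix (Fin n) (Fin n) ℂ, (∀ i, matrixAbs (Z i) = Z₀) →
      spec (U * Z₀) = spec Z₀ → IsUnit Z₀ → U = 1) := by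
  choose Q hQ hAQ using fun i => exists_unitary_conj_eq_matrixAbs (Z i)
  have hne : (Finset.univ : Finset (Fin m)).Nonempty := by
    by_contra h
    rw [Finset.not_nonempty_iff_eq_empty] at h
    simp [h] at hw1
  have hA : ∀ i, (matrixAbs (Z i)).PosSemidef := fun i =>
    nonneg_iff_posSemidef.1 (CFC.abs_nonneg _)
  have hAA : ∀ i, (Z i)ᴴ * Z i = matrixAbs (Z i) * matrixAbs (Z i) := fun i =>
    (CFC.abs_mul_abs (Z i)).symm
  simp only [hAA]
  obtain ⟨S, hS⟩ : ∃ S, S = ∑ i, w i • matrixAbs (Z i) := ⟨_, rfl⟩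
  rw [← hS]
  have hSp : S.PosSemidef := by
    rw [hS]; exact posSemidef_sum _ fun i _ => (hA i).smul (hw i).le
  obtain ⟨V, hV, s, hSV⟩ := hSp.1.exists_unitary_conj
  obtain ⟨hs, hle⟩ := prod_eigenvalue_div_le hw hw1 hV hQ (s := s)
    (a := fun i k => singularValue (Z i) k) (by rw [← hSV, hS]; simp only [← hAQ]) hZ
  have hS1 : (1 - S).PosDef := by
    rw [hSV, one_sub_unitary_conj hV]
    exact posDef_unitary_conj_diagonal hV fun k => by linarith [(hs k).2]
  have hXi : ∀ i, (1 - matrixAbs (Z i) * matrixAbs (Z i)).PosDef := by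
    intro i
    have e : matrixAbs (Z i) * matrixAbs (Z i) =
        Q i * diagonal (fun k => ((singularValue (Z i) k ^ 2 : ℝ) : ℂ)) * (Q i)ᴴ := by
      have hQQ : (Q i)ᴴ * Q i = 1 := mem_unitaryGroup_iff'.1 (hQ i)
      set D : Matrix (Fin n) (Fin n) ℂ := diagonal fun k => (singularValue (Z i) k : ℂ) with hD
      have hDD : diagonal (fun k => ((singularValue (Z i) k ^ 2 : ℝ) : ℂ)) = D * D := by
        rw [hD, diagonal_mul_diagonal]; simp [sq]
      rw [hAQ, hDD, ← hD]
      calc _ = Q i * D * ((Q i)ᴴ * Q i) * D * (Q i)ᴴ := by simp only [Matrix.mul_assoc]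
        _ = _ := by rw [hQQ, Matrix.mul_one]; simp only [Matrix.mul_assoc]
    rw [e, one_sub_unitary_conj (hQ i)]
    exact posDef_unitary_conj_diagonal (hQ i) fun k => by nlinarith [(hZ i k).1, (hZ i k).2]
  have hX : (1 - ∑ i, w i • (matrixAbs (Z i) * matrixAbs (Z i))).PosDef := by
    have e : 1 - ∑ i, w i • (matrixAbs (Z i) * matrixAbs (Z i)) =
        ∑ i, w i • (1 - matrixAbs (Z i) * matrixAbs (Z i)) := by
      simp only [smul_sub, Finset.sum_sub_distrib]
      rw [← Finset.sum_smul, hw1, one_smul]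
    rw [e]
    exact posDef_sum hne fun i _ => (hXi i).smul (hw i)
  obtain ⟨hN, hNeq⟩ := re_det_one_sub_sum_le hw hw1 (fun i => (hA i).1) hS hX
  obtain ⟨hD, hDeq⟩ := sq_re_det_one_sub_le hSp hS1 hU
  have hp : (1 - S).det = ((∏ k, (1 - s k) : ℝ) : ℂ) := by
    rw [hSV, one_sub_unitary_conj hV, det_unitary_conj hV, det_diagonal]; push_cast; rfl
  have hq : (1 + S).det = ((∏ k, (1 + s k) : ℝ) : ℂ) := by
    rw [hSV, one_add_unitary_conj hV, det_unitary_conj hV, det_diagonal]; push_cast; rfl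
  have hpq : (1 - S * S).det = ((∏ k, (1 - s k) : ℝ) : ℂ) * ((∏ k, (1 + s k) : ℝ) : ℂ) := by
    rw [← hp, ← hq, ← det_mul]
    congr 1
    noncomm_ring
  rw [Finset.prod_div_distrib] at hle
  have hp0 : 0 < ∏ k, (1 - s k) := Finset.prod_pos fun k _ => by linarith [(hs k).2]
  have hq0 : 0 < ∏ k, (1 + s k) := Finset.prod_pos fun k _ => by linarith [(hs k).1]
  rw [hpq, ← Complex.ofReal_mul, Complex.ofReal_re] at hN hNeq
  rw [hp, Complex.ofReal_re] at hD hDeq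
  obtain ⟨-, hXdet⟩ := hX.re_det_pos
  rw [← hXdet, ← Complex.ofReal_div, Complex.real_le_real, Complex.ofReal_inj]
  have hspec : spec (U * S) = spec S → U * S = S := fun h => by
    refine hDeq ?_
    rw [det_one_sub_eq_of_spec_eq h, hp, Complex.norm_real, Real.norm_eq_abs, sq_abs]
  have hconst : ∀ Z₀ : Matrix (Fin n) (Fin n) ℂ, (∀ i, matrixAbs (Z i) = Z₀) → Z₀ = S := by
    intro Z₀ h
    rw [hS]
    simp only [h]
    rw [← Finset.sum_smul, hw1, one_smul]
  have hdpos : 0 < ‖(1 - U * S).det‖ ^ 2 := lt_of_lt_of_le (by positivity) hD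
  generalize hNd : (1 - ∑ i, w i • (matrixAbs (Z i) * matrixAbs (Z i))).det.re = N at *
  generalize hdd : ‖(1 - U * S).det‖ ^ 2 = d at *
  generalize hpd : ∏ k, (1 - s k) = p at *
  generalize hqd : ∏ k, (1 + s k) = q at *
  have hmid : N / d ≤ q / p := by
    rw [div_le_div_iff₀ hdpos hp0]
    nlinarith
  refine ⟨fun h => ?_, hmid.trans hle, ⟨fun h => ?_, ?_⟩, ?_⟩
  · rw [h] at hdd; simp at hdd; linarith
  · have h1 : N / d = q / p := le_antisymm hmid (h ▸ hle)
    rw [div_eq_div_iff hdpos.ne' hp0.ne'] at h1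
    -- Here `q * d = N * p ≤ p² * q ≤ d * q`, so both inequalities are equalities.
    have h2 : d = p ^ 2 := by nlinarith
    have h3 : N = p * q := by
      rw [h2] at h1
      have : (N - p * q) * p = 0 := by linear_combination h1
      linarith [(mul_eq_zero.1 this).resolve_right hp0.ne']
    exact ⟨S, hNeq h3, by rw [hDeq h2]⟩
  · rintro ⟨Z₀, h1, h2⟩
    obtain rfl := hconst Z₀ h1
    have hd2 : d = p ^ 2 := by
      rw [← hdd, hspec h2, hp, Complex.norm_real, Real.norm_eq_abs, sq_abs]
    have hN2 : N = p * q := by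
      rw [← hNd]
      simp only [h1]
      rw [← Finset.sum_smul, hw1, one_smul, hpq, ← Complex.ofReal_mul, Complex.ofReal_re]
    -- As `|Z i| = S`, this product is `det (1 + S) / det (1 - S)` for each `i`, so the weighted
    -- geometric mean collapses to it.
    have hi : ∀ i, ∏ k, ((1 + singularValue (Z i) k) / (1 - singularValue (Z i) k)) = q / p := by
      intro i
      have e1 := h1 i ▸ hp
      have e2 := h1 i ▸ hq
      rw [hAQ i, one_sub_unitary_conj (hQ i), det_unitary_conj (hQ i), det_diagonal,
        ← Complex.ofReal_prod, Complex.ofReal_inj] at e1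
      rw [hAQ i, one_add_unitary_conj (hQ i), det_unitary_conj (hQ i), det_diagonal,
        ← Complex.ofReal_prod, Complex.ofReal_inj] at e2
      rw [Finset.prod_div_distrib, e1, e2]
    rw [Finset.prod_comm]
    have hr : ∀ i k, 0 ≤ (1 + singularValue (Z i) k) / (1 - singularValue (Z i) k) := fun i k =>
      div_nonneg (by linarith [(hZ i k).1]) (by linarith [(hZ i k).2])
    simp only [fun i => Real.finsetProd_rpow Finset.univ _ (fun k _ => hr i k) (w i), hi]
    rw [← Real.rpow_sum_of_pos (by positivity), hw1, Real.rpow_one, hd2, hN2]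
    field_simp
  · intro Z₀ h1 h2 h3
    obtain rfl := hconst Z₀ h1
    exact h3.mul_left_injective (by simpa using hspec h2)
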